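/- All rings are associative with unity, not necessarily commutative. Let $R\subseteq A$ be rings and $x_1,\dots,x_n\in A$. Recall that $A=\sigma(R)\langle x_1,\dots,x_n\rangle$ is a \emph{skew PBW extension} of $R$ if: (a) $A$ is a free left $R$-module with basis the monomials $x_1^{\alpha_1}\cdots x_n^{\alpha_n}$, $\alpha\in\mathbb N^n$; (b) for all $i$ and all $r\in R\setminus\{0\}$ there is $c_{i,r}\in R\setminus\{0\}$ with $x_ir-c_{i,r}x_i\in R$; (c) for all $i,j$ there is $c_{i,j}\in R\setminus\{0\}$ with $x_jx_i-c_{i,j}x_ix_j\in R+Rx_1+\cdots+Rx_n$. Then $x_ir=\sigma_i(r)x_i+\delta_i(r)$ for uniquely determined maps $\sigma_i,\delta_i:R\to R$; the extension is \emph{bijective} if every $\sigma_i$ is bijective and $c_{i,j}$ is invertible for all $i<j$. The ring $R$ is \emph{weak skew-Armendariz} (with respect to $A$ and $x_1,\dots,x_n$) if, for all $f=a_0+a_1x_1+\cdots+a_nx_n$ and $g=b_0+b_1x_1+\cdots+b_nx_n$ in $A$ with $a_i,b_i\in R$, $fg=0$ implies $a_0b_k=0$ for every $0\le k\le n$. \textbf{Theorem.}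 Let $A=\sigma(R)\langle x_1,\dots,x_n\rangle$ be a bijective skew PBW extension of $R$, let $S$ be the set of regular elements (two-sided non-zero-divisors) of $R$, and suppose that the classical quotient ring $Q(R)$ exists, i.e. that $R$ satisfies both the left and the right Ore condition with respect to $S$, so that $Q(R)=S^{-1}R=RS^{-1}$. Then the left ring of fractions $S^{-1}A$ exists and is, with the canonical map $Q(R)\to S^{-1}A$ and the variables $\frac{x_1}{1},\dots,\frac{x_n}{1}$, a bijective skew PBW extension of $Q(R)$ (the induced extension); and $R$ is weak skew-Armendariz with respect to $A$ if and only if $Q(R)$ is weak skew-Armendariz with respect to $S^{-1}A$. -/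

import Mathlib

open scoped nonZeroDivisors

universe u v

namespace SkewPBW

/-- The standard monomial `x₁ ^ α₁ * x₂ ^ α₂ * ⋯ * xₙ ^ αₙ`, in this order. -/
def stdMonomial {A : Type v} [Ring A] {n : ℕ} (x : Fin n → A) (α : Fin n → ℕ) : A :=
  (List.ofFn fun i => x i ^ α i).prod

/-- `A` is a skew PBW extension `σ(R)⟨x₁, …, xₙ⟩` of `R`, the inclusion of `R` into `A` being the
injective ring homomorphism `ι`. The left `R`-module structure of `A` is `r • a = ι r * a`. -/
structure IsSkewPBWExtension {R : Type u} {A : Type v} [Ring R] [Ring A] (ι : R →+* A)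
    {n : ℕ} (x : Fin n → A) : Prop where
  injective : Function.Injective ι
  linearIndependent :
    letI : Module R A := Module.compHom A ι
    LinearIndependent R (stdMonomial x)
  span_eq_top :
    letI : Module R A := Module.compHom A ι
    Submodule.span R (Set.range (stdMonomial x)) = ⊤
  comm_coeff : ∀ (i : Fin n) (r : R), r ≠ 0 →
    ∃ c : R, c ≠ 0 ∧ x i * ι r - ι c * x i ∈ ι.range
  comm_var : ∀ i j : Fin n, ∃ c : R, c ≠ 0 ∧
    ∃ (r₀ : R) (r : Fin n → R), x j * x i - ι c * (x i * x j) = ι r₀ + ∑ k, ι (r k) * x k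

/-- For linear polynomials `f = a₀ + ∑ aᵢ xᵢ` and `g = b₀ + ∑ bᵢ xᵢ` of the extension,
`f g = 0` forces `a₀ bₖ = 0` for `k = 0, 1, …, n`. -/
def IsWeakSkewArmendariz {R : Type u} {A : Type v} [Ring R] [Ring A] (ι : R →+* A)
    {n : ℕ} (x : Fin n → A) : Prop :=
  ∀ (a₀ b₀ : R) (a b : Fin n → R),
    (ι a₀ + ∑ i, ι (a i) * x i) * (ι b₀ + ∑ i, ι (b i) * x i) = 0 →
      a₀ * b₀ = 0 ∧ ∀ k, a₀ * b k = 0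

namespace IsSkewPBWExtension

section

variable {R : Type u} {A : Type v} [Ring R] [Ring A] {ι : R →+* A} {n : ℕ} {x : Fin n → A}

theorem exists_sigma_delta (h : IsSkewPBWExtension ι x) (i : Fin n) (r : R) :
    ∃ c d : R, x i * ι r = ι c * x i + ι d := by
  by_cases hr : r = 0
  · exact ⟨0, 0, by simp [hr]⟩
  · obtain ⟨c, -, d, hd⟩ := h.comm_coeff i r hr
    exact ⟨c, d, by rw [hd]; abel⟩

/-- The map `σᵢ : R → R`, determined by `xᵢ r = σᵢ(r) xᵢ + δᵢ(r)`. -/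
noncomputable def sigma (h : IsSkewPBWExtension ι x) (i : Fin n) (r : R) : R :=
  (h.exists_sigma_delta i r).choose

/-- The map `δᵢ : R → R`, determined by `xᵢ r = σᵢ(r) xᵢ + δᵢ(r)`. -/
noncomputable def delta (h : IsSkewPBWExtension ι x) (i : Fin n) (r : R) : R :=
  (h.exists_sigma_delta i r).choose_spec.choose

theorem x_mul (h : IsSkewPBWExtension ι x) (i : Fin n) (r : R) :
    x i * ι r = ι (h.sigma i r) * x i + ι (h.delta i r) :=
  (h.exists_sigma_delta i r).choose_spec.choose_spec

/-- The (unique) elements `c i j` with `xⱼ xᵢ - c i j xᵢ xⱼ ∈ R + R x₁ + ⋯ + R xₙ`. -/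
noncomputable def c (h : IsSkewPBWExtension ι x) (i j : Fin n) : R :=
  (h.comm_var i j).choose

/-- The extension is bijective: every `σᵢ` is bijective and `c i j` is invertible for `i < j`. -/
structure IsBijective (h : IsSkewPBWExtension ι x) : Prop where
  sigma_bijective : ∀ i, Function.Bijective (h.sigma i)
  isUnit_c : ∀ i j, i < j → IsUnit (h.c i j)

/-! ### Coordinates with respect to the standard monomials -/

theorem exists_coord (h : IsSkewPBWExtension ι x) :
    ∃ f : A →+ ((Fin n → ℕ) →₀ R),
      (∀ r a α, f (ι r * a) α = r * f a α) ∧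
      (∀ α, f (stdMonomial x α) = Finsupp.single α 1) ∧
      ∀ a, a = (f a).sum fun α r => ι r * stdMonomial x α := by
  let _ : Module R A := Module.compHom A ι
  let b : Module.Basis (Fin n → ℕ) R A :=
    Module.Basis.mk h.linearIndependent (le_of_eq h.span_eq_top.symm)
  refine ⟨b.repr.toLinearMap.toAddMonoidHom, ?_, ?_, ?_⟩
  · intro r a α
    have : ι r * a = r • a := rfl
    rw [this]
    simp
  · intro α
    have : stdMonomial x α = b α := by simp [b]
    rw [this]
    simp
  · intro a
    have := b.linearCombination_repr a
    rw [Finsupp.linearCombination_apply] at this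
    refine this.symm.trans ?_
    refine Finset.sum_congr rfl fun α _ => ?_
    have : stdMonomial x α = b α := by simp [b]
    simp only [this]
    rfl

/-- The coordinates of an element of `A` in the basis of standard monomials. -/
noncomputable def coord (h : IsSkewPBWExtension ι x) : A →+ ((Fin n → ℕ) →₀ R) :=
  h.exists_coord.choose

theorem coord_mul (h : IsSkewPBWExtension ι x) (r : R) (a : A) (α : Fin n → ℕ) :
    h.coord (ι r * a) α = r * h.coord a α :=
  h.exists_coord.choose_spec.1 r a α

theorem coord_stdMonomial (h : IsSkewPBWExtension ι x) (α : Fin n → ℕ) :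
    h.coord (stdMonomial x α) = Finsupp.single α 1 :=
  h.exists_coord.choose_spec.2.1 α

theorem eq_sum (h : IsSkewPBWExtension ι x) (a : A) :
    a = ∑ α ∈ (h.coord a).support, ι (h.coord a α) * stdMonomial x α :=
  h.exists_coord.choose_spec.2.2 a

/-! ### The standard monomials -/

theorem stdMonomial_zero {m : ℕ} (y : Fin m → A) : stdMonomial y 0 = 1 := by
  simp [stdMonomial]

theorem x_mul_stdMonomial {m : ℕ} (y : Fin m → A) (i : Fin m) (α : Fin m → ℕ)
    (hα : ∀ j < i, α j = 0) :
    y i * stdMonomial y α = stdMonomial y (α + Pi.single i 1) := by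
  induction m with
  | zero => exact i.elim0
  | succ m ih =>
    have hs : ∀ β : Fin (m + 1) → ℕ, stdMonomial y β =
        y 0 ^ β 0 * stdMonomial (fun j => y j.succ) (fun j => β j.succ) := by
      intro β
      simp [stdMonomial, List.ofFn_succ]
    refine Fin.cases (motive := fun i => (∀ j < i, α j = 0) →
      y i * stdMonomial y α = stdMonomial y (α + Pi.single i 1)) ?_ ?_ i hα
    · intro _
      rw [hs, hs, ← mul_assoc, ← pow_succ']
      simp
    · intro i hα
      have h0 : α 0 = 0 := hα 0 (Fin.succ_pos i)
      rw [hs, hs, h0, pow_zero, one_mul,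
        ih (fun j => y j.succ) i (fun j => α j.succ) (fun j hj => hα _ (by simpa using hj))]
      have : (α + Pi.single i.succ 1 : Fin (m + 1) → ℕ) 0 = 0 := by
        simp [h0]
      rw [this, pow_zero, one_mul]
      congr 1
      funext j
      simp [Pi.single_apply]

theorem sum_add_single {m : ℕ} (α : Fin m → ℕ) (i : Fin m) :
    ∑ j, (α + Pi.single i 1 : Fin m → ℕ) j = ∑ j, α j + 1 := by
  simp [Finset.sum_add_distrib]

theorem exists_peel {m : ℕ} (α : Fin m → ℕ) (hα : α ≠ 0) :
    ∃ (k : Fin m) (β : Fin m → ℕ), (∀ j < k, β j = 0) ∧ α k ≠ 0 ∧ α = β + Pi.single k 1 := by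
  obtain ⟨k, hk, hmin⟩ := WellFounded.has_min (wellFounded_lt (α := Fin m))
    {k | α k ≠ 0} (Function.ne_iff.1 hα)
  refine ⟨k, α - Pi.single k 1, ?_, hk, ?_⟩
  · intro j hj
    have : α j = 0 := by
      by_contra hne
      exact hmin j hne hj
    simp [this]
  · funext j
    by_cases hj : j = k
    · subst hj
      have : α j ≠ 0 := hk
      simp
      omega
    · simp [hj]

/-! ### The degree filtration -/

/-- The elements of `A` of degree less than `d`. -/
def low (h : IsSkewPBWExtension ι x) (d : ℕ) : AddSubgroup A where
  carrier := {a | ∀ α : Fin n → ℕ, d ≤ ∑ i, α i → h.coord a α = 0}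
  zero_mem' := by intro α _; simp
  add_mem' := by
    intro a b ha hb α hα
    simp [ha α hα, hb α hα]
  neg_mem' := by
    intro a ha α hα
    simp [ha α hα]

theorem low_mono (h : IsSkewPBWExtension ι x) {d e : ℕ} (hde : d ≤ e) : h.low d ≤ h.low e :=
  fun _ ha α hα => ha α (hde.trans hα)

theorem mul_mem_low (h : IsSkewPBWExtension ι x) {d : ℕ} (r : R) {a : A} (ha : a ∈ h.low d) :
    ι r * a ∈ h.low d := by
  intro α hα
  rw [coord_mul, ha α hα, mul_zero]

theorem stdMonomial_mem_low (h : IsSkewPBWExtension ι x) {d : ℕ} {α : Fin n → ℕ}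
    (hα : ∑ i, α i < d) : stdMonomial x α ∈ h.low d := by
  intro β hβ
  rw [coord_stdMonomial, Finsupp.single_apply, if_neg]
  rintro rfl
  omega

theorem x_mul_mem_low_of (h : IsSkewPBWExtension ι x) {d e : ℕ} (hde : d ≤ e) (i : Fin n)
    (H : ∀ α : Fin n → ℕ, ∑ j, α j < d → x i * stdMonomial x α ∈ h.low e)
    {a : A} (ha : a ∈ h.low d) : x i * a ∈ h.low e := by
  rw [h.eq_sum a, Finset.mul_sum]
  refine sum_mem fun α hα => ?_
  have hd : ∑ j, α j < d := by
    by_contra hlt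
    exact (Finsupp.mem_support_iff.1 hα) (ha α (not_lt.1 hlt))
  rw [← mul_assoc, h.x_mul, add_mul, mul_assoc]
  exact add_mem (h.mul_mem_low _ (H α hd))
    (h.mul_mem_low _ (h.stdMonomial_mem_low (hd.trans_le hde)))

theorem x_mul_stdMonomial_mem_low (h : IsSkewPBWExtension ι x) (m : ℕ) :
    ∀ (i : Fin n) (α : Fin n → ℕ), ∑ j, α j = m → x i * stdMonomial x α ∈ h.low (m + 2) := by
  induction m using Nat.strong_induction_on with
  | _ m ihm =>
  intro i
  induction i using WellFoundedLT.induction with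
  | _ i ihi =>
  intro α hα
  have hsmall : ∀ i, (∀ j < i, α j = 0) → x i * stdMonomial x α ∈ h.low (m + 2) := by
    intro i hi
    rw [x_mul_stdMonomial x i α hi]
    refine h.stdMonomial_mem_low ?_
    rw [sum_add_single]
    omega
  by_cases h0 : α = 0
  · exact hsmall i fun j _ => by simp [h0]
  obtain ⟨k, β, hβ, hk, hαβ⟩ := exists_peel α h0
  have hβm : ∑ j, β j + 1 = m := by
    rw [← sum_add_single β k, ← hαβ, hα]
  by_cases hik : i ≤ k
  · refine hsmall i fun j hj => ?_
    have hjk : j < k := hj.trans_le hik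
    rw [hαβ]
    simp [hβ j hjk, hjk.ne]
  · have hki : k < i := not_le.1 hik
    have hmon : stdMonomial x α = x k * stdMonomial x β := by
      rw [x_mul_stdMonomial x k β hβ, ← hαβ]
    obtain ⟨c, -, r₀, r, hc⟩ := h.comm_var k i
    have hc' : x i * x k = ι c * (x k * x i) + (ι r₀ + ∑ l, ι (r l) * x l) := by
      rw [← hc]; abel
    have hlow : ∀ l, x l * stdMonomial x β ∈ h.low (m + 1) := by
      intro l
      exact h.low_mono (by omega) (ihm (∑ j, β j) (by omega) l β rfl)
    rw [hmon, ← mul_assoc, hc', add_mul, add_mul, Finset.sum_mul]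
    refine add_mem ?_ (add_mem ?_ (sum_mem fun l _ => ?_))
    · rw [mul_assoc, mul_assoc]
      refine h.mul_mem_low _ ?_
      refine h.x_mul_mem_low_of (by omega : m + 1 ≤ m + 2) k ?_ (hlow i)
      intro γ hγ
      rcases (Nat.lt_succ_iff_lt_or_eq.1 hγ) with hlt | heq
      · exact h.low_mono (by omega) (ihm _ hlt k γ rfl)
      · exact ihi k hki γ heq
    · exact h.mul_mem_low _ (h.stdMonomial_mem_low (by omega))
    · rw [mul_assoc]
      exact h.low_mono (by omega) (h.mul_mem_low _ (hlow l))

theorem x_mul_mem_low (h : IsSkewPBWExtension ι x) {d : ℕ} (i : Fin n) {a : A}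
    (ha : a ∈ h.low d) : x i * a ∈ h.low (d + 1) :=
  h.x_mul_mem_low_of (by omega) i
    (fun α hα => h.low_mono (by omega) (h.x_mul_stdMonomial_mem_low _ i α rfl)) ha

/-! ### The maps `σᵢ` and regular elements -/

theorem sigma_eq (h : IsSkewPBWExtension ι x) (i : Fin n) {r c d : R}
    (hr : x i * ι r = ι c * x i + ι d) : h.sigma i r = c := by
  have hx : x i = stdMonomial x (Pi.single i 1) := by
    have := x_mul_stdMonomial x i 0 (fun _ _ => rfl)
    rwa [stdMonomial_zero, mul_one, zero_add] at this
  have key : ∀ c d : R, h.coord (ι c * x i + ι d) (Pi.single i 1) = c := by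
    intro c d
    have h1 : ι d = ι d * stdMonomial x 0 := by rw [stdMonomial_zero, mul_one]
    have hne : (0 : Fin n → ℕ) ≠ Pi.single i 1 := by
      intro h0
      simpa using congrFun h0 i
    rw [h1, hx, map_add, Finsupp.add_apply, coord_mul, coord_mul, coord_stdMonomial,
      coord_stdMonomial, Finsupp.single_eq_same, Finsupp.single_apply, if_neg hne]
    simp
  rw [← key (h.sigma i r) (h.delta i r), ← h.x_mul, hr, key]

theorem sigma_zero (h : IsSkewPBWExtension ι x) (i : Fin n) : h.sigma i 0 = 0 :=
  h.sigma_eq i (d := 0) (by simp)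

theorem sigma_mul (h : IsSkewPBWExtension ι x) (i : Fin n) (r s : R) :
    h.sigma i (r * s) = h.sigma i r * h.sigma i s := by
  refine h.sigma_eq i (d := h.sigma i r * h.delta i s + h.delta i r * s) ?_
  rw [map_mul, ← mul_assoc, h.x_mul, add_mul, mul_assoc, h.x_mul]
  simp only [map_mul, map_add, mul_add, mul_assoc, add_assoc]

theorem sigma_mem (h : IsSkewPBWExtension ι x) (hb : h.IsBijective) (i : Fin n) {s : R}
    (hs : s ∈ R⁰) : h.sigma i s ∈ R⁰ := by
  have hinj := (hb.sigma_bijective i).1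
  refine ⟨fun y hy => ?_, fun y hy => ?_⟩
  · obtain ⟨z, rfl⟩ := (hb.sigma_bijective i).2 y
    rw [← sigma_mul, ← h.sigma_zero i] at hy
    rw [hs.1 z (hinj hy), sigma_zero]
  · obtain ⟨z, rfl⟩ := (hb.sigma_bijective i).2 y
    rw [← sigma_mul, ← h.sigma_zero i] at hy
    rw [hs.2 z (hinj hy), sigma_zero]

theorem stdMonomial_mul (h : IsSkewPBWExtension ι x) (hb : h.IsBijective) {s : R} (hs : s ∈ R⁰)
    (m : ℕ) : ∀ α : Fin n → ℕ, ∑ i, α i = m →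
      ∃ t ∈ R⁰, stdMonomial x α * ι s - ι t * stdMonomial x α ∈ h.low m := by
  induction m with
  | zero =>
    intro α hα
    have : α = 0 := by
      funext i
      simpa using (Finset.sum_eq_zero_iff.1 hα) i (Finset.mem_univ i)
    refine ⟨s, hs, ?_⟩
    rw [this, stdMonomial_zero, one_mul, mul_one, sub_self]
    exact zero_mem _
  | succ m ih =>
    intro α hα
    have h0 : α ≠ 0 := by
      rintro rfl
      simp at hα
    obtain ⟨k, β, hβ, -, hαβ⟩ := exists_peel α h0
    have hβm : ∑ j, β j = m := by
      have := sum_add_single β k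
      rw [← hαβ, hα] at this
      omega
    obtain ⟨t, ht, hlow⟩ := ih β hβm
    refine ⟨h.sigma k t, h.sigma_mem hb k ht, ?_⟩
    have hmon : stdMonomial x α = x k * stdMonomial x β := by
      rw [x_mul_stdMonomial x k β hβ, ← hαβ]
    have hcalc : stdMonomial x α * ι s - ι (h.sigma k t) * stdMonomial x α =
        x k * (stdMonomial x β * ι s - ι t * stdMonomial x β)
          + ι (h.delta k t) * stdMonomial x β := by
      rw [hmon, mul_sub, ← mul_assoc (x k) (ι t), h.x_mul, add_mul]
      simp only [mul_assoc]
      abel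
    rw [hcalc]
    exact add_mem (h.x_mul_mem_low k hlow)
      (h.mul_mem_low _ (h.stdMonomial_mem_low (by omega)))

theorem eq_zero_of_mul_eq_zero (h : IsSkewPBWExtension ι x) (hb : h.IsBijective) {s : R}
    (hs : s ∈ R⁰) {a : A} (ha : a * ι s = 0) : a = 0 := by
  by_contra hne
  have hsupp : (h.coord a).support.Nonempty := by
    by_contra hem
    apply hne
    rw [h.eq_sum a, Finset.not_nonempty_iff_eq_empty.1 hem, Finset.sum_empty]
  obtain ⟨α, hα, hmax⟩ := Finset.exists_max_image _ (fun α : Fin n → ℕ => ∑ i, α i) hsupp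
  choose t ht hlow using fun β : Fin n → ℕ => h.stdMonomial_mul hb hs _ β rfl
  have hco : ∀ β ∈ (h.coord a).support,
      h.coord (ι (h.coord a β) * stdMonomial x β * ι s) α
        = if β = α then h.coord a α * t α else 0 := by
    intro β hβ
    have h1 : ι (h.coord a β) * stdMonomial x β * ι s =
        ι (h.coord a β) * (stdMonomial x β * ι s - ι (t β) * stdMonomial x β)
          + ι (h.coord a β * t β) * stdMonomial x β := by
      rw [map_mul, mul_sub]
      simp only [mul_assoc]
      abel
    have h2 := h.mul_mem_low (h.coord a β) (hlow β) α (hmax β hβ)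
    rw [h1, map_add, Finsupp.add_apply, h2, zero_add, coord_mul, coord_stdMonomial,
      Finsupp.single_apply]
    split_ifs with hβα
    · rw [hβα, mul_one]
    · rw [mul_zero]
  have hzero : h.coord (a * ι s) α = h.coord a α * t α := by
    conv_lhs => rw [h.eq_sum a]
    rw [Finset.sum_mul, map_sum, Finsupp.finsetSum_apply, Finset.sum_congr rfl hco,
      Finset.sum_ite_eq' _ α, if_pos hα]
  rw [ha, map_zero, Finsupp.zero_apply] at hzero
  exact (Finsupp.mem_support_iff.1 hα) ((ht α).2 _ hzero.symm)

/-! ### Localization at the regular elements of `R` -/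

theorem exists_ore [OreLocalization.OreSet R⁰] (h : IsSkewPBWExtension ι x) (hb : h.IsBijective)
    (a : A) : ∀ s ∈ R⁰, ∃ (b : A) (t : R), t ∈ R⁰ ∧ ι t * a = b * ι s := by
  have hR : ∀ (r s : R), s ∈ R⁰ → ∃ (b t : R), t ∈ R⁰ ∧ t * r = b * s := fun r s hs =>
    ⟨_, _, (OreLocalization.oreDenom r (⟨s, hs⟩ : R⁰)).2, OreLocalization.ore_eq r ⟨s, hs⟩⟩
  have hcoe : ∀ r : R, ∀ s ∈ R⁰, ∃ (b : A) (t : R), t ∈ R⁰ ∧ ι t * ι r = b * ι s := by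
    intro r s hs
    obtain ⟨b, t, ht, e⟩ := hR r s hs
    exact ⟨ι b, t, ht, by rw [← map_mul, e, map_mul]⟩
  have hmul : ∀ a a' : A, (∀ s ∈ R⁰, ∃ (b : A) (t : R), t ∈ R⁰ ∧ ι t * a = b * ι s) →
      (∀ s ∈ R⁰, ∃ (b : A) (t : R), t ∈ R⁰ ∧ ι t * a' = b * ι s) →
      ∀ s ∈ R⁰, ∃ (b : A) (t : R), t ∈ R⁰ ∧ ι t * (a * a') = b * ι s := by
    intro a a' ha ha' s hs
    obtain ⟨b', t', ht', e'⟩ := ha' s hs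
    obtain ⟨b, t, ht, e⟩ := ha t' ht'
    exact ⟨b * b', t, ht, by rw [← mul_assoc, e, mul_assoc, e', mul_assoc]⟩
  have hadd : ∀ a a' : A, (∀ s ∈ R⁰, ∃ (b : A) (t : R), t ∈ R⁰ ∧ ι t * a = b * ι s) →
      (∀ s ∈ R⁰, ∃ (b : A) (t : R), t ∈ R⁰ ∧ ι t * a' = b * ι s) →
      ∀ s ∈ R⁰, ∃ (b : A) (t : R), t ∈ R⁰ ∧ ι t * (a + a') = b * ι s := by
    intro a a' ha ha' s hs
    obtain ⟨b, t, ht, e⟩ := ha s hs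
    obtain ⟨b', t', ht', e'⟩ := ha' s hs
    obtain ⟨p, q, hq, epq⟩ := hR t t' ht'
    refine ⟨ι q * b + ι p * b', q * t, mul_mem hq ht, ?_⟩
    rw [mul_add, add_mul, map_mul, mul_assoc, e, ← mul_assoc, ← map_mul, epq, map_mul,
      mul_assoc (ι p), e', mul_assoc (ι q), mul_assoc (ι p)]
  have hx : ∀ i, ∀ s ∈ R⁰, ∃ (b : A) (t : R), t ∈ R⁰ ∧ ι t * x i = b * ι s := by
    intro i s hs
    obtain ⟨d, q, hq, e⟩ := hR (h.delta i s) s hs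
    refine ⟨ι q * x i - ι d, q * h.sigma i s, mul_mem hq (h.sigma_mem hb i hs), ?_⟩
    rw [sub_mul, mul_assoc, h.x_mul, mul_add, ← map_mul ι q (h.delta i s), e, ← map_mul ι d s,
      add_sub_cancel_right, map_mul, mul_assoc]
  have hone : ∀ s ∈ R⁰, ∃ (b : A) (t : R), t ∈ R⁰ ∧ ι t * 1 = b * ι s :=
    fun s hs => ⟨1, s, hs, by simp⟩
  have hpow : ∀ (i : Fin n) (k : ℕ), ∀ s ∈ R⁰,
      ∃ (b : A) (t : R), t ∈ R⁰ ∧ ι t * x i ^ k = b * ι s := by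
    intro i k
    induction k with
    | zero => simpa using hone
    | succ k ih =>
      rw [pow_succ]
      exact hmul _ _ ih (hx i)
  have hlist : ∀ l : List A,
      (∀ a ∈ l, ∀ s ∈ R⁰, ∃ (b : A) (t : R), t ∈ R⁰ ∧ ι t * a = b * ι s) →
      ∀ s ∈ R⁰, ∃ (b : A) (t : R), t ∈ R⁰ ∧ ι t * l.prod = b * ι s := by
    intro l
    induction l with
    | nil => intro _; simpa using hone
    | cons a l ih =>
      intro hl
      rw [List.prod_cons]
      exact hmul _ _ (hl a (by simp)) (ih fun a ha => hl a (by simp [ha]))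
  rw [h.eq_sum a]
  refine Finset.sum_induction _
    (fun a => ∀ s ∈ R⁰, ∃ (b : A) (t : R), t ∈ R⁰ ∧ ι t * a = b * ι s) hadd ?_ ?_
  · exact fun s hs => ⟨0, s, hs, by simp⟩
  · intro α _
    refine hmul _ _ (hcoe _) (hlist _ ?_)
    intro a ha
    obtain ⟨i, rfl⟩ := (List.mem_ofFn' _ _).1 ha
    exact hpow i _

/-- The image in `A` of the set of regular elements of `R` satisfies the left Ore conditions. -/
@[reducible]
noncomputable def oreSet [OreLocalization.OreSet R⁰] (h : IsSkewPBWExtension ι x)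
    (hb : h.IsBijective) : OreLocalization.OreSet (R⁰.map ι) :=
  Classical.choice <| OreLocalization.nonempty_oreSet_iff.2 <| by
    constructor
    · rintro a b ⟨_, s, hs, rfl⟩ hab
      refine ⟨1, ?_⟩
      have : (a - b) * ι s = 0 := by
        rw [sub_mul, sub_eq_zero]
        exact hab
      rw [sub_eq_zero.1 (h.eq_zero_of_mul_eq_zero hb hs this)]
    · rintro a ⟨_, s, hs, rfl⟩
      obtain ⟨b, t, ht, e⟩ := h.exists_ore hb a s hs
      exact ⟨b, ⟨ι t, t, ht, rfl⟩, e⟩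

/-- The left ring of fractions `S⁻¹A`, where `S` is the set of regular elements of `R`. -/
abbrev Localized [OreLocalization.OreSet R⁰] (h : IsSkewPBWExtension ι x)
    (hb : h.IsBijective) : Type v :=
  letI := h.oreSet hb
  OreLocalization (R⁰.map ι) A

noncomputable instance [OreLocalization.OreSet R⁰] (h : IsSkewPBWExtension ι x)
    (hb : h.IsBijective) : Ring (h.Localized hb) :=
  letI := h.oreSet hb
  (inferInstance : Ring (OreLocalization (R⁰.map ι) A))

/-- The canonical homomorphism `A → S⁻¹A`, `a ↦ a / 1`. -/
noncomputable def toLocalized [OreLocalization.OreSet R⁰] (h : IsSkewPBWExtension ι x)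
    (hb : h.IsBijective) : A →+* h.Localized hb :=
  letI := h.oreSet hb
  OreLocalization.numeratorRingHom

/-- The homomorphism `Q(R) = S⁻¹R → S⁻¹A` induced by `R → A`, `a / s ↦ a / s`. -/
noncomputable def localizedMap [OreLocalization.OreSet R⁰] (h : IsSkewPBWExtension ι x)
    (hb : h.IsBijective) : OreLocalization R⁰ R →+* h.Localized hb :=
  letI := h.oreSet hb
  OreLocalization.universalHom ((h.toLocalized hb).comp ι)
    (IsUnit.liftRight (((h.toLocalized hb).comp ι).toMonoidHom.comp R⁰.subtype) fun s =>
      OreLocalization.numerator_isUnit (⟨ι s, s, s.2, rfl⟩ : R⁰.map ι))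
    (fun _ => rfl)

/-- The variables `xᵢ / 1` of `S⁻¹A`. -/
noncomputable def localizedVar [OreLocalization.OreSet R⁰] (h : IsSkewPBWExtension ι x)
    (hb : h.IsBijective) (i : Fin n) : h.Localized hb :=
  h.toLocalized hb (x i)

end

end IsSkewPBWExtension

end SkewPBW

namespace SkewPBW

section

variable {R A Q B : Type*} [Ring R] [Ring A] [Ring Q] [Ring B]

/-! Only a few properties of the fractions matter, collected in `IsFractionSquare`: `R` and `A`
embed in `Q` and `B`, regular `s` become units, and every fraction is cleared on the left by a
regular element of `R`. A `Q`-linear relation between monomials thus becomes an `R`-linear one, so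
the monomial basis survives. Applying `xᵢ` to `s q = a` gives `σᵢ'(s⁻¹a) = σᵢ(s)⁻¹ σᵢ(a)`, where
`σᵢ(s)` is again regular.

For the Armendariz property, take `F G = 0` over `Q`, with coefficients `qᵢ` of `F` and `pᵢ` of `G`.
A common left denominator gives `s F` over `R`. Here `G` must be cleared on the right, where the
right Ore condition enters: passing `t` through `xᵢ` produces `pᵢ σᵢ(t)` and adds `pᵢ δᵢ(t)` to the
constant term. `exists_linear_denominator` finds a `t` handling all of these at once. The hypothesis
on `R` applied to `(s F)(G t) = 0` gives `s q₀ pₖ σₖ(t) = 0`, hence `q₀ pₖ = 0` for `k ≥ 1`; the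
`δᵢ` terms then drop out of the constant term, and `q₀ p₀ = 0`. The converse is restriction along
the embedding. -/

/-- The data making `Q` and `B` the rings of left fractions of `R` and `A` with respect to the
regular elements of `R`, compatibly with `ι : R → A` and `ι' : Q → B`. -/
structure IsFractionSquare (ι : R →+* A) (κ : R →+* Q) (φ : A →+* B) (ι' : Q →+* B) : Prop where
  comm : ∀ r, ι' (κ r) = φ (ι r)
  injective_base : Function.Injective κ
  injective_top : Function.Injective φ
  isUnit : ∀ s ∈ R⁰, IsUnit (κ s)
  exists_base : ∀ q, ∃ s ∈ R⁰, ∃ a, κ s * q = κ a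
  exists_top : ∀ b, ∃ s ∈ R⁰, ∃ a, φ (ι s) * b = φ a

theorem map_stdMonomial (φ : A →+* B) {n : ℕ} (x : Fin n → A) (α : Fin n → ℕ) :
    φ (stdMonomial x α) = stdMonomial (fun i => φ (x i)) α := by
  simp [stdMonomial, map_list_prod, List.map_ofFn, Function.comp_def]

/-! ### Injectivity of `σᵢ`, uniqueness of `c i j`, and regular coefficients. -/

namespace IsSkewPBWExtension

variable {ι : R →+* A} {n : ℕ} {x : Fin n → A}

theorem sigma_ne_zero (h : IsSkewPBWExtension ι x) (i : Fin n) {r : R} (hr : r ≠ 0) :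
    h.sigma i r ≠ 0 := by
  obtain ⟨c, hc, d, hd⟩ := h.comm_coeff i r hr
  rwa [h.sigma_eq i (c := c) (d := d) (by rw [hd]; abel)]

theorem sigma_sub (h : IsSkewPBWExtension ι x) (i : Fin n) (r s : R) :
    h.sigma i (r - s) = h.sigma i r - h.sigma i s := by
  refine h.sigma_eq i (d := h.delta i r - h.delta i s) ?_
  rw [map_sub, mul_sub, h.x_mul, h.x_mul, map_sub, map_sub, sub_mul]
  abel

/-- Additivity together with `c_{i,r} ≠ 0` suffices, so over `Q` only surjectivity of `σᵢ` remains
to be proved. -/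
theorem sigma_injective (h : IsSkewPBWExtension ι x) (i : Fin n) :
    Function.Injective (h.sigma i) := by
  intro r s hrs
  by_contra hne
  exact h.sigma_ne_zero i (sub_ne_zero.2 hne) (by rw [sigma_sub, hrs, sub_self])

/-- Allows a denominator found in the form `σᵢ(s)` to be pulled back to a denominator `s`. -/
theorem mem_of_sigma_mem (h : IsSkewPBWExtension ι x) (i : Fin n) {s : R}
    (hs : h.sigma i s ∈ R⁰) : s ∈ R⁰ := by
  refine ⟨fun y hy => h.sigma_injective i ?_, fun y hy => h.sigma_injective i ?_⟩
  · rw [sigma_zero]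
    exact hs.1 _ (by rw [← sigma_mul, hy, sigma_zero])
  · rw [sigma_zero]
    exact hs.2 _ (by rw [← sigma_mul, hy, sigma_zero])

theorem x_eq_stdMonomial {A : Type*} [Ring A] {n : ℕ} (x : Fin n → A) (i : Fin n) :
    x i = stdMonomial x (Pi.single i 1) := by
  have := x_mul_stdMonomial x i 0 (fun _ _ => rfl)
  rwa [stdMonomial_zero, mul_one, zero_add] at this

/-- For `i < j` the product `xᵢ xⱼ` is a standard monomial, and `c` is the coordinate of `xⱼ xᵢ`
there, since the remainder has degree below 2. This identifies the chosen constants over `Q` with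
the images of those over `R`. -/
theorem c_eq (h : IsSkewPBWExtension ι x) {i j : Fin n} (hij : i < j) {c r₀ : R} {r : Fin n → R}
    (hc : x j * x i - ι c * (x i * x j) = ι r₀ + ∑ k, ι (r k) * x k) : h.c i j = c := by
  have hmon : x i * x j = stdMonomial x (Pi.single j 1 + Pi.single i 1) := by
    rw [x_eq_stdMonomial x j]
    exact x_mul_stdMonomial x i _ fun k hk => by simp [(hk.trans hij).ne]
  have key : ∀ (d s₀ : R) (s : Fin n → R),
      x j * x i - ι d * (x i * x j) = ι s₀ + ∑ k, ι (s k) * x k →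
      h.coord (x j * x i) (Pi.single j 1 + Pi.single i 1) = d := by
    intro d s₀ s hd
    have hlow : ι s₀ + ∑ k, ι (s k) * x k ∈ h.low 2 := by
      refine add_mem ?_ (sum_mem fun k _ => h.mul_mem_low _ ?_)
      · rw [← mul_one (ι s₀), ← stdMonomial_zero x]
        exact h.mul_mem_low _ (h.stdMonomial_mem_low (by simp))
      · rw [x_eq_stdMonomial x k]
        exact h.stdMonomial_mem_low (by simp)
    have h0 := hlow (Pi.single j 1 + Pi.single i 1) (by rw [sum_add_single]; simp)
    rw [sub_eq_iff_eq_add.1 hd, map_add h.coord, Finsupp.add_apply, h0, coord_mul, hmon,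
      coord_stdMonomial]
    simp
  obtain ⟨-, r₀', r', hr'⟩ := (h.comm_var i j).choose_spec
  exact (key _ _ _ hr').symm.trans (key _ _ _ hc)

/-- Left multiplication by `s` acts coordinatewise. This yields injectivity of `A → S⁻¹A`. -/
theorem eq_zero_of_coeff_mul_eq_zero (h : IsSkewPBWExtension ι x) {s : R} (hs : s ∈ R⁰) {a : A}
    (ha : ι s * a = 0) : a = 0 := by
  rw [h.eq_sum a]
  refine Finset.sum_eq_zero fun α _ => ?_
  have : s * h.coord a α = 0 := by rw [← h.coord_mul, ha]; simp
  rw [hs.1 _ this, map_zero, zero_mul]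

end IsSkewPBWExtension

/-! ### Transfer of the skew PBW structure and of bijectivity to fractions. -/

namespace IsFractionSquare

variable {ι : R →+* A} {κ : R →+* Q} {φ : A →+* B} {ι' : Q →+* B} {n : ℕ} {x : Fin n → A}

theorem exists_common_denominator (H : IsFractionSquare ι κ φ ι') {T : Type*} (t : Finset T)
    (q : T → Q) : ∃ s ∈ R⁰, ∀ i ∈ t, ∃ a, κ s * q i = κ a := by
  classical
  induction t using Finset.induction_on with
  | empty => exact ⟨1, one_mem _, by simp⟩
  | insert i t _ ih =>
    obtain ⟨s, hs, hst⟩ := ih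
    obtain ⟨u, hu, a, ha⟩ := H.exists_base (κ s * q i)
    refine ⟨u * s, mul_mem hu hs, fun j hj => ?_⟩
    rw [map_mul]
    rcases Finset.mem_insert.1 hj with rfl | hj
    · exact ⟨a, by rw [mul_assoc, ha]⟩
    · obtain ⟨b, hb⟩ := hst j hj
      exact ⟨u * b, by rw [mul_assoc, hb, map_mul]⟩

theorem injective (H : IsFractionSquare ι κ φ ι') (h : IsSkewPBWExtension ι x) :
    Function.Injective ι' := by
  rw [injective_iff_map_eq_zero]
  intro q hq
  obtain ⟨s, hs, a, ha⟩ := H.exists_base q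
  have h0 : φ (ι a) = 0 := by rw [← H.comm, ← ha, map_mul, hq, mul_zero]
  have ha0 : a = 0 := h.injective (H.injective_top (by rw [h0, map_zero, map_zero]))
  rw [ha0, map_zero] at ha
  exact (H.isUnit s hs).mul_right_eq_zero.1 ha

theorem linearIndependent (H : IsFractionSquare ι κ φ ι') (h : IsSkewPBWExtension ι x) :
    letI : Module Q B := Module.compHom B ι'
    LinearIndependent Q (stdMonomial fun i => φ (x i)) := by
  let _ : Module Q B := Module.compHom B ι'
  let _ : Module R A := Module.compHom A ι
  refine linearIndependent_iff'.2 fun t g hg α hα => ?_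
  have hg' : ∑ α ∈ t, ι' (g α) * stdMonomial (fun i => φ (x i)) α = 0 := hg
  obtain ⟨s, hs, hst⟩ := H.exists_common_denominator t g
  choose! a ha using hst
  have h0 : φ (∑ α ∈ t, ι (a α) * stdMonomial x α) = 0 := by
    calc _ = ι' (κ s) * ∑ α ∈ t, ι' (g α) * stdMonomial (fun i => φ (x i)) α := by
          rw [map_sum, Finset.mul_sum]
          refine Finset.sum_congr rfl fun β hβ => ?_
          rw [map_mul, map_stdMonomial, ← H.comm, ← ha β hβ, map_mul, mul_assoc]
      _ = 0 := by rw [hg', mul_zero]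
  have h1 := H.injective_top (h0.trans (map_zero φ).symm)
  have h2 := linearIndependent_iff'.1 h.linearIndependent t a h1 α hα
  have h3 := ha α hα
  rw [h2, map_zero] at h3
  exact (H.isUnit s hs).mul_right_eq_zero.1 h3

theorem span_eq_top (H : IsFractionSquare ι κ φ ι') (h : IsSkewPBWExtension ι x) :
    letI : Module Q B := Module.compHom B ι'
    Submodule.span Q (Set.range (stdMonomial fun i => φ (x i))) = ⊤ := by
  let _ : Module Q B := Module.compHom B ι'
  refine Submodule.eq_top_iff'.2 fun b => ?_
  obtain ⟨s, hs, a, ha⟩ := H.exists_top b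
  obtain ⟨u, hu⟩ := H.isUnit s hs
  have hb : b = (↑u⁻¹ : Q) • φ a := by
    change b = ι' ↑u⁻¹ * φ a
    rw [← ha, ← H.comm, ← hu, ← mul_assoc, ← map_mul, Units.inv_mul, map_one, one_mul]
  rw [hb, h.eq_sum a, map_sum]
  refine Submodule.smul_mem _ _ (sum_mem fun α _ => ?_)
  rw [map_mul, map_stdMonomial, ← H.comm]
  exact Submodule.smul_mem _ (κ _) (Submodule.subset_span ⟨α, rfl⟩)

theorem x_mul_base (H : IsFractionSquare ι κ φ ι') (h : IsSkewPBWExtension ι x) (i : Fin n)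
    (r : R) : φ (x i) * ι' (κ r) = ι' (κ (h.sigma i r)) * φ (x i) + ι' (κ (h.delta i r)) := by
  rw [H.comm, ← map_mul, h.x_mul, map_add, map_mul, H.comm, H.comm]

theorem isSkewPBWExtension (H : IsFractionSquare ι κ φ ι') (h : IsSkewPBWExtension ι x)
    (hb : h.IsBijective) : IsSkewPBWExtension ι' fun i => φ (x i) where
  injective := H.injective h
  linearIndependent := H.linearIndependent h
  span_eq_top := H.span_eq_top h
  comm_coeff i q hq := by
    obtain ⟨s, hs, a, ha⟩ := H.exists_base q
    obtain ⟨u, hu⟩ := H.isUnit s hs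
    obtain ⟨v, hv⟩ := H.isUnit _ (h.sigma_mem hb i hs)
    have ha0 : a ≠ 0 := by
      rintro rfl
      rw [map_zero] at ha
      exact hq ((H.isUnit s hs).mul_right_eq_zero.1 ha)
    -- From `s q = a`: `(σᵢ(s) xᵢ + δᵢ(s)) q = σᵢ(a) xᵢ + δᵢ(a)`. Solve for `xᵢ q` using `v =
    -- σᵢ(s)`.
    refine ⟨↑v⁻¹ * κ (h.sigma i a), fun h0 => h.sigma_ne_zero i ha0 (H.injective_base ?_),
      ↑v⁻¹ * (κ (h.delta i a) - κ (h.delta i s) * q), ?_⟩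
    · rw [map_zero]
      exact v⁻¹.isUnit.mul_right_eq_zero.1 h0
    · have e1 : φ (x i) * (ι' (κ s) * ι' q) =
          ι' (κ (h.sigma i a)) * φ (x i) + ι' (κ (h.delta i a)) := by
        rw [← map_mul, ha, H.x_mul_base h]
      rw [← mul_assoc, H.x_mul_base h, ← hv, add_mul, ← eq_sub_iff_add_eq, mul_assoc] at e1
      have e2 : ι' (↑v⁻¹) * ι' ↑v = 1 := by rw [← map_mul, Units.inv_mul, map_one]
      rw [← one_mul (φ (x i) * ι' q), ← e2, mul_assoc, e1]
      simp only [map_mul, map_sub, mul_sub, mul_add, mul_assoc]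
      abel
  comm_var i j := by
    obtain ⟨c, hc, r₀, r, hr⟩ := h.comm_var i j
    refine ⟨κ c, fun h0 => hc (H.injective_base (by rw [h0, map_zero])), κ r₀,
      fun k => κ (r k), ?_⟩
    simpa [H.comm] using congrArg φ hr

theorem sigma_base (H : IsFractionSquare ι κ φ ι') (h : IsSkewPBWExtension ι x)
    (h' : IsSkewPBWExtension ι' fun i => φ (x i)) (i : Fin n) (r : R) :
    h'.sigma i (κ r) = κ (h.sigma i r) :=
  h'.sigma_eq i (H.x_mul_base h i r)

theorem isBijective (H : IsFractionSquare ι κ φ ι') (h : IsSkewPBWExtension ι x)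
    (hb : h.IsBijective) (h' : IsSkewPBWExtension ι' fun i => φ (x i)) : h'.IsBijective where
  sigma_bijective i := by
    refine ⟨h'.sigma_injective i, fun q => ?_⟩
    obtain ⟨s, hs, a, ha⟩ := H.exists_base q
    -- Numerator and denominator of `q` are both pulled back through `σᵢ`; the quotient of the
    -- preimages maps to `q`.
    obtain ⟨s, rfl⟩ := (hb.sigma_bijective i).2 s
    obtain ⟨a, rfl⟩ := (hb.sigma_bijective i).2 a
    obtain ⟨u, hu⟩ := H.isUnit s (h.mem_of_sigma_mem i hs)
    refine ⟨↑u⁻¹ * κ a, (H.isUnit _ hs).mul_left_cancel ?_⟩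
    rw [ha, ← H.sigma_base h h', ← H.sigma_base h h', ← h'.sigma_mul, ← mul_assoc, ← hu,
      Units.mul_inv, one_mul]
  isUnit_c i j hij := by
    obtain ⟨-, r₀, r, hr⟩ := (h.comm_var i j).choose_spec
    have : h'.c i j = κ (h.c i j) := by
      refine h'.c_eq hij (r₀ := κ r₀) (r := fun k => κ (r k)) ?_
      change x j * x i - ι (h.c i j) * (x i * x j) = _ at hr
      simpa [H.comm] using congrArg φ hr
    rw [this]
    exact (hb.isUnit_c i j hij).map κ

/-! ### Right denominators of linear polynomials and the Armendariz property. -/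

theorem exists_twisted_denominator (h : IsSkewPBWExtension ι x) (hb : h.IsBijective)
    (hright : ∀ q : Q, ∃ s ∈ R⁰, ∃ a, q * κ s = κ a) (p : Fin n → Q) (T : Finset (Fin n)) :
    ∃ t ∈ R⁰, ∀ i ∈ T, ∃ a, p i * κ (h.sigma i t) = κ a := by
  classical
  induction T using Finset.induction_on with
  | empty => exact ⟨1, one_mem _, by simp⟩
  | insert i T _ ih =>
    obtain ⟨t, ht, hT⟩ := ih
    obtain ⟨u, hu, a, ha⟩ := hright (p i * κ (h.sigma i t))
    -- Surjectivity of `σᵢ` lets the new right denominator be written `σᵢ(u)`. Replacing `t` by `t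
    -- u` keeps the earlier coefficients in `R`, as `σⱼ(t u) = σⱼ(t) σⱼ(u)`.
    obtain ⟨u, rfl⟩ := (hb.sigma_bijective i).2 u
    refine ⟨t * u, mul_mem ht (h.mem_of_sigma_mem i hu), fun j hj => ?_⟩
    rw [h.sigma_mul, map_mul, ← mul_assoc]
    rcases Finset.mem_insert.1 hj with rfl | hj
    · exact ⟨a, ha⟩
    · obtain ⟨b, hb⟩ := hT j hj
      exact ⟨b * h.sigma j u, by rw [hb, map_mul]⟩

theorem linear_mul_base (H : IsFractionSquare ι κ φ ι') (h : IsSkewPBWExtension ι x) (p₀ : Q)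
    (p : Fin n → Q) (t : R) :
    (ι' p₀ + ∑ i, ι' (p i) * φ (x i)) * ι' (κ t) =
      ι' (p₀ * κ t + ∑ i, p i * κ (h.delta i t)) +
        ∑ i, ι' (p i * κ (h.sigma i t)) * φ (x i) := by
  simp only [add_mul, Finset.sum_mul, mul_assoc, H.x_mul_base h, mul_add,
    Finset.sum_add_distrib, map_add, map_sum, map_mul]
  abel

theorem exists_linear_denominator (h : IsSkewPBWExtension ι x) (hb : h.IsBijective)
    (hright : ∀ q : Q, ∃ s ∈ R⁰, ∃ a, q * κ s = κ a) (p₀ : Q) (p : Fin n → Q) :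
    ∃ t ∈ R⁰, ∃ (b₀ : R) (b : Fin n → R), p₀ * κ t + ∑ i, p i * κ (h.delta i t) = κ b₀ ∧
      ∀ i, p i * κ (h.sigma i t) = κ (b i) := by
  obtain ⟨t, ht, hT⟩ := exists_twisted_denominator h hb hright p Finset.univ
  choose b hbp using fun i => hT i (Finset.mem_univ i)
  -- The factor `u` clears the constant term left by `t`. The twisted Leibniz rule `hdelta` adds
  -- only the terms `pᵢ σᵢ(t) δᵢ(u) = bᵢ δᵢ(u)`, already in `R`.
  obtain ⟨u, hu, a, ha⟩ := hright (p₀ * κ t + ∑ i, p i * κ (h.delta i t))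
  have hdelta : ∀ i, h.delta i (t * u) = h.sigma i t * h.delta i u + h.delta i t * u := by
    intro i
    have e := h.x_mul i (t * u)
    have e' : x i * ι (t * u) = ι (h.sigma i (t * u)) * x i +
        ι (h.sigma i t * h.delta i u + h.delta i t * u) := by
      rw [map_mul, ← mul_assoc, h.x_mul, add_mul, mul_assoc, h.x_mul, h.sigma_mul]
      simp only [map_mul, map_add, mul_add, mul_assoc, add_assoc]
    exact h.injective (add_left_cancel (e.symm.trans e'))
  refine ⟨t * u, mul_mem ht hu, a + ∑ i, b i * h.delta i u, fun i => b i * h.sigma i u, ?_, ?_⟩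
  · rw [map_add, ← ha, map_sum, add_mul, Finset.sum_mul, add_assoc, ← Finset.sum_add_distrib,
      map_mul, mul_assoc]
    congr 1
    refine Finset.sum_congr rfl fun i _ => ?_
    rw [hdelta, map_add, map_mul, map_mul, mul_add, ← mul_assoc, hbp, map_mul, mul_assoc,
      add_comm]
  · intro i
    rw [h.sigma_mul, map_mul, ← mul_assoc, hbp, map_mul]

theorem isWeakSkewArmendariz_iff (H : IsFractionSquare ι κ φ ι') (h : IsSkewPBWExtension ι x)
    (hb : h.IsBijective) (hright : ∀ q : Q, ∃ s ∈ R⁰, ∃ a, q * κ s = κ a) :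
    IsWeakSkewArmendariz ι x ↔ IsWeakSkewArmendariz ι' fun i => φ (x i) := by
  constructor
  · intro hR q₀ p₀ q p hqp
    -- Indexing by `Option (Fin n)` gives one denominator for `q₀` and all `qᵢ`.
    obtain ⟨s, hs, hsq⟩ := H.exists_common_denominator Finset.univ
      (fun o : Option (Fin n) => o.elim q₀ q)
    obtain ⟨a₀, ha₀⟩ := hsq none (Finset.mem_univ _)
    choose a ha using fun i => hsq (some i) (Finset.mem_univ _)
    simp only [Option.elim_none, Option.elim_some] at ha₀ ha
    obtain ⟨t, ht, b₀, b, hb₀, hbp⟩ := exists_linear_denominator h hb hright p₀ p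
    have hf : φ (ι a₀ + ∑ i, ι (a i) * x i) =
        ι' (κ s) * (ι' q₀ + ∑ i, ι' (q i) * φ (x i)) := by
      simp only [map_add, map_sum, map_mul, ← H.comm, ← ha₀, ← ha, mul_add, Finset.mul_sum,
        mul_assoc]
    have hg : φ (ι b₀ + ∑ i, ι (b i) * x i) =
        (ι' p₀ + ∑ i, ι' (p i) * φ (x i)) * ι' (κ t) := by
      rw [H.linear_mul_base h, hb₀]
      simp only [map_add, map_sum, map_mul φ, ← H.comm, hbp]
    have hfg : (ι a₀ + ∑ i, ι (a i) * x i) * (ι b₀ + ∑ i, ι (b i) * x i) = 0 := by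
      apply H.injective_top
      rw [map_mul, hf, hg, mul_assoc, ← mul_assoc (ι' q₀ + _), hqp, zero_mul, mul_zero, map_zero]
    obtain ⟨h0, hk⟩ := hR a₀ b₀ a b hfg
    have hp : ∀ k, κ a₀ * p k = 0 := by
      intro k
      refine (H.isUnit _ (h.sigma_mem hb k ht)).mul_left_eq_zero.1 ?_
      rw [mul_assoc, hbp, ← map_mul, hk, map_zero]
    -- Multiplying `hb₀` by `a₀` kills the `δᵢ` terms by `hp`, leaving `a₀ p₀ t = a₀ b₀ = 0`.
    have hp₀ : κ a₀ * p₀ = 0 := by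
      refine (H.isUnit t ht).mul_left_eq_zero.1 ?_
      have e := congrArg (κ a₀ * ·) hb₀
      simpa [mul_add, Finset.mul_sum, ← mul_assoc, hp, ← map_mul, h0] using e
    rw [← ha₀, mul_assoc] at hp₀
    refine ⟨(H.isUnit s hs).mul_right_eq_zero.1 hp₀, fun k => ?_⟩
    have := hp k
    rw [← ha₀, mul_assoc] at this
    exact (H.isUnit s hs).mul_right_eq_zero.1 this
  · intro hQ a₀ b₀ a b hab
    have e := congrArg φ hab
    simp only [map_mul, map_add, map_sum, ← H.comm, map_zero] at e
    obtain ⟨h0, hk⟩ := hQ (κ a₀) (κ b₀) (fun i => κ (a i)) (fun i => κ (b i)) e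
    refine ⟨H.injective_base ?_, fun k => H.injective_base ?_⟩
    · rw [map_mul, h0, map_zero]
    · rw [map_mul, hk, map_zero]

end IsFractionSquare

/-! ### Ore localizations form a fraction square. -/

theorem _root_.OreLocalization.exists_numerator_mul_eq {M : Submonoid R}
    [OreLocalization.OreSet M] (q : OreLocalization M R) :
    ∃ s ∈ M, ∃ a, OreLocalization.numeratorRingHom (S := M) s * q =
      OreLocalization.numeratorRingHom a := by
  induction q using OreLocalization.ind with
  | _ a s =>
    refine ⟨s, s.2, a, ?_⟩
    exact OreLocalization.mul_cancel

theorem IsSkewPBWExtension.isFractionSquare {ι : R →+* A} {n : ℕ} {x : Fin n → A}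
    [OreLocalization.OreSet R⁰] (h : IsSkewPBWExtension ι x) (hb : h.IsBijective) :
    IsFractionSquare ι (OreLocalization.numeratorRingHom (S := R⁰)) (h.toLocalized hb)
      (h.localizedMap hb) where
  comm r := by
    let _ := h.oreSet hb
    exact OreLocalization.universalHom_commutes ((h.toLocalized hb).comp ι) _ (fun _ => rfl)
  injective_base := OreLocalization.numeratorHom_inj
    (fun s hs => hs.1)
  injective_top := by
    let _ := h.oreSet hb
    exact OreLocalization.numeratorHom_inj (S := R⁰.map ι) (by
      rintro _ ⟨s, hs, rfl⟩ a ha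
      exact h.eq_zero_of_coeff_mul_eq_zero hs ha)
  isUnit s hs := OreLocalization.numerator_isUnit (⟨s, hs⟩ : R⁰)
  exists_base := OreLocalization.exists_numerator_mul_eq
  exists_top b := by
    let _ := h.oreSet hb
    obtain ⟨_, ⟨s, hs, rfl⟩, a, ha⟩ :=
      OreLocalization.exists_numerator_mul_eq (M := R⁰.map ι) b
    exact ⟨s, hs, a, ha⟩

/-- If `q = s⁻¹ a` and `a t = s b`, then `q t = b`: left fractions are also right fractions. -/
theorem _root_.OreLocalization.exists_mul_numerator_eq [OreLocalization.OreSet R⁰]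
    (hright : ∀ a : R, ∀ s ∈ R⁰, ∃ b : R, ∃ t ∈ R⁰, a * t = s * b) (q : OreLocalization R⁰ R) :
    ∃ s ∈ R⁰, ∃ a, q * OreLocalization.numeratorRingHom (S := R⁰) s =
      OreLocalization.numeratorRingHom a := by
  obtain ⟨s, hs, a, ha⟩ := OreLocalization.exists_numerator_mul_eq q
  obtain ⟨b, t, ht, e⟩ := hright a s hs
  refine ⟨t, ht, b, (OreLocalization.numerator_isUnit (⟨s, hs⟩ : R⁰)).mul_left_cancel ?_⟩
  change OreLocalization.numeratorRingHom s * _ = OreLocalization.numeratorRingHom s * _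
  rw [← mul_assoc, ha, ← map_mul, e, map_mul]

end

end SkewPBW

theorem mainTheorem5 {R : Type u} {A : Type v} [Ring R] [Ring A] (ι : R →+* A) {n : ℕ}
    (x : Fin n → A) (h : SkewPBW.IsSkewPBWExtension ι x) (hb : h.IsBijective)
    [OreLocalization.OreSet R⁰]
    (hright : ∀ a : R, ∀ s ∈ R⁰, ∃ b : R, ∃ t ∈ R⁰, a * t = s * b) :
    (∃ h' : SkewPBW.IsSkewPBWExtension (h.localizedMap hb) (h.localizedVar hb),
      h'.IsBijective) ∧
    (SkewPBW.IsWeakSkewArmendariz ι x ↔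
      SkewPBW.IsWeakSkewArmendariz (h.localizedMap hb) (h.localizedVar hb)) := by
  have H := h.isFractionSquare hb
  have h' := H.isSkewPBWExtension h hb
  exact ⟨⟨h', H.isBijective h hb h'⟩,
    H.isWeakSkewArmendariz_iff h hb (OreLocalization.exists_mul_numerator_eq hright)⟩
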